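/- Let $X$ be a set of distinct variables, $\mathbb Z[X]$ the polynomial ring over the integers in these variables, and $\mathbb Z(X)$ its field of quotients. For $Y\subseteq X$ let $\mathbb Z[Y]\subseteq\mathbb Z[X]$ be the subring of polynomials involving only variables from $Y$, and let $R_Y^+$ be the additive subgroup of $\mathbb Z(X)$ generated by all fractions $p/q$ with $p,q\in\mathbb Z[Y]$ and $q$ not divisible in $\mathbb Z[X]$ by any integer other than $\pm1$ (in particular $q\neq 0$). Then: (1) $R_X^+$ is a free abelian group. (2) More generally, let $n\ge 0$, let $Y\subseteq X$, let $x(1),\dots,x(n)$ be pairwise distinct elements of $X\setminus Y$, and put $W=\{x(1),\dots,x(n)\}$ and $W(\ell)=W\setminus\{x(\ell)\}$ for $1\le\ell\le n$. Then $$R^+_{W\cup Y}\Big/\sum_{\ell=1}^n R^+_{W(\ell)\cup Y}$$ is a free abelian group (for $n=0$ the sum is the zero subgroup). -/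

import Mathlib

namespace FreeRing

/-- An integer polynomial `q` in the variables `X` is not divisible by any integer other than
`1` and `-1`. In particular `q ≠ 0`. -/
def NotIntDivisible {X : Type*} (q : MvPolynomial X ℤ) : Prop :=
  ∀ m : ℤ, MvPolynomial.C m ∣ q → IsUnit m

/-- The additive group `R_Y⁺` for a set `Y ⊆ X` of variables: the additive subgroup of the field
of quotients `ℤ(X)` of `ℤ[X]` generated by the fractions `p / q` with `p, q ∈ ℤ[Y]` and `q` not
divisible by any integer other than `1` and `-1`. Here `ℤ[Y]` is
`MvPolynomial.supported ℤ Y`, the subring of polynomials in `ℤ[X]` that involve only variables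
from `Y`. -/
noncomputable def R {X : Type*} (Y : Set X) : AddSubgroup (FractionRing (MvPolynomial X ℤ)) :=
  AddSubgroup.closure
    {r | ∃ p ∈ MvPolynomial.supported ℤ Y, ∃ q ∈ MvPolynomial.supported ℤ Y,
      NotIntDivisible q ∧
      r = algebraMap (MvPolynomial X ℤ) (FractionRing (MvPolynomial X ℤ)) p /
        algebraMap (MvPolynomial X ℤ) (FractionRing (MvPolynomial X ℤ)) q}

theorem R_mono {X : Type*} {Y Z : Set X} (h : Y ⊆ Z) : R Y ≤ R Z := by
  apply AddSubgroup.closure_mono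
  rintro r ⟨p, hp, q, hq, hd, rfl⟩
  exact ⟨p, MvPolynomial.supported_mono h hp, q, MvPolynomial.supported_mono h hq, hd, rfl⟩

/-- The sum `∑_ℓ R⁺_{W(ℓ) ∪ Y}`, where `W = {x(1), …, x(n)}` and `W(ℓ) = W ∖ {x(ℓ)}`;
it is the zero subgroup when `n = 0`. -/
noncomputable def faceSum {X : Type*} (Y : Set X) {n : ℕ} (x : Fin n → X) :
    AddSubgroup (FractionRing (MvPolynomial X ℤ)) :=
  ⨆ l : Fin n, R ((Set.range x \ {x l}) ∪ Y)

/-- The sum is a subgroup of `R⁺_{W ∪ Y}`, so the quotient of the latter by the former makes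
sense. -/
theorem faceSum_le {X : Type*} (Y : Set X) {n : ℕ} (x : Fin n → X) :
    faceSum Y x ≤ R (Set.range x ∪ Y) :=
  iSup_le fun _ => R_mono (Set.union_subset_union_left Y Set.sdiff_subset)

end FreeRing

namespace Module.Free

/-- A module generated by a family of submodules indexed by a well-order, such that each
of them is free modulo the sum of the preceding ones, is free. -/
theorem of_wellFounded_filtration {R M I : Type*} [Ring R] [AddCommGroup M] [Module R M]
    [LinearOrder I] [WellFoundedLT I] (N : I → Submodule R M)
    (htop : ⨆ a, N a = ⊤)
    (hfree : ∀ a, Module.Free R (N a ⧸ (⨆ b, ⨆ (_ : b < a), N b).submoduleOf (N a))) :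
    Module.Free R M := by
  classical
  have key : ∀ a, ∃ C : Submodule R M, Module.Free R C ∧ C ≤ N a ∧
      Disjoint C (⨆ b, ⨆ (_ : b < a), N b) ∧ N a ≤ C ⊔ ⨆ b, ⨆ (_ : b < a), N b := by
    intro a
    set P := (⨆ b, ⨆ (_ : b < a), N b).submoduleOf (N a)
    obtain ⟨s, hs⟩ := Module.projective_lifting_property P.mkQ LinearMap.id P.mkQ_surjective
    have hs' : ∀ z, P.mkQ (s z) = z := fun z => LinearMap.congr_fun hs z
    have hinj : Function.Injective ((N a).subtype ∘ₗ s) :=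
      (N a).injective_subtype.comp (Function.LeftInverse.injective hs')
    refine ⟨LinearMap.range ((N a).subtype ∘ₗ s),
      Module.Free.of_equiv (LinearEquiv.ofInjective _ hinj), ?_, ?_, ?_⟩
    · rintro _ ⟨z, rfl⟩
      exact (s z).2
    · rw [Submodule.disjoint_def]
      rintro _ ⟨z, rfl⟩ hz
      have : s z ∈ P := hz
      have h0 : z = 0 := by
        rw [← hs' z]
        exact (Submodule.Quotient.mk_eq_zero P).2 this
      simp [h0]
    · intro y hy
      have h1 : (⟨y, hy⟩ : N a) - s (P.mkQ ⟨y, hy⟩) ∈ P := by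
        rw [← Submodule.Quotient.mk_eq_zero, ← Submodule.mkQ_apply, map_sub, hs', sub_self]
      have h2 : y = ((N a).subtype ∘ₗ s) (P.mkQ ⟨y, hy⟩) +
          (((⟨y, hy⟩ : N a) - s (P.mkQ ⟨y, hy⟩) : N a) : M) := by simp
      rw [h2]
      exact Submodule.add_mem_sup ⟨_, rfl⟩ h1
  choose C hC hle hdis hsup using key
  have hindep : iSupIndep C := by
    rw [iSupIndep_iff_finsetSum_eq_zero_imp_eq_zero]
    intro s
    induction s using Finset.induction_on_max with
    | empty => simp
    | insert a s ha ih =>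
      intro v hv hsum
      have has : a ∉ s := fun h => lt_irrefl _ (ha a h)
      rw [Finset.sum_insert has] at hsum
      have hlt : ∑ i ∈ s, v i ∈ ⨆ b, ⨆ (_ : b < a), N b := by
        refine Submodule.sum_mem _ fun i hi => ?_
        exact Submodule.mem_iSup_of_mem i (Submodule.mem_iSup_of_mem (ha i hi)
          (hle i (hv i (Finset.mem_insert_of_mem hi))))
      have hva : v a = 0 := by
        refine (Submodule.disjoint_def.1 (hdis a)) _ (hv a (Finset.mem_insert_self _ _)) ?_
        rw [eq_neg_of_add_eq_zero_left hsum]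
        exact Submodule.neg_mem _ hlt
      rw [hva, zero_add] at hsum
      intro i hi
      rcases Finset.mem_insert.1 hi with rfl | hi
      · exact hva
      · exact ih v (fun j hj => hv j (Finset.mem_insert_of_mem hj)) hsum i hi
  have hspan : iSup C = ⊤ := by
    rw [eq_top_iff, ← htop]
    refine iSup_le fun a => ?_
    induction a using WellFoundedLT.induction with
    | ind a ih =>
      exact (hsup a).trans (sup_le (le_iSup C a) (iSup_le fun b => iSup_le fun hb => ih b hb))
  have hinternal := DirectSum.isInternal_submodule_of_iSupIndep_of_iSup_eq_top hindep hspan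
  exact Module.Free.of_basis (hinternal.collectedBasis fun a => Module.Free.chooseBasis R (C a))

/-- The quotient by the kernel of a map with free range is free. -/
theorem quotient_of_map {R M F : Type*} [Ring R] [AddCommGroup M] [Module R M]
    [AddCommGroup F] [Module R F] (f : M →ₗ[R] F) (N : Submodule R M) (hN : LinearMap.ker f = N)
    (h : Module.Free R (LinearMap.range f)) : Module.Free R (M ⧸ N) := by
  subst hN
  exact Module.Free.of_equiv f.quotKerEquivRange.symm

/-- Over a principal ideal domain, submodules of free modules are free. -/
theorem submodule_of_pid {R M : Type*} [CommRing R] [IsDomain R] [IsPrincipalIdealRing R]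
    [AddCommGroup M] [Module R M] [Module.Free R M] (P : Submodule R M) : Module.Free R P := by
  classical
  let B := Module.Free.chooseBasis R M
  obtain ⟨_, _⟩ := exists_wellFoundedLT (Module.Free.ChooseBasisIndex R M)
  let S : Module.Free.ChooseBasisIndex R M → Submodule R P := fun a =>
    (Finsupp.supported R R (Set.Iic a)).comap (B.repr.toLinearMap ∘ₗ P.subtype)
  have hS : ∀ a (y : P), y ∈ S a ↔ ∀ i, a < i → B.repr y i = 0 := by
    intro a y
    simp [S, Finsupp.mem_supported']
  have hcover : ∀ y : P, ∀ T : Finset _, (B.repr y).support ⊆ T → y ≠ 0 → ∃ a ∈ T, y ∈ S a := by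
    intro y T hT hy
    have hne : (B.repr y).support.Nonempty := by
      rw [Finsupp.support_nonempty_iff]
      simpa using hy
    refine ⟨_, hT ((B.repr y).support.max'_mem hne), ?_⟩
    rw [hS]
    intro i hi
    by_contra h
    exact absurd ((B.repr y).support.le_max' i (Finsupp.mem_support_iff.2 h)) (not_le.2 hi)
  refine of_wellFounded_filtration S ?_ fun a => ?_
  · rw [eq_top_iff]
    intro y _
    by_cases hy : y = 0
    · rw [hy]; exact Submodule.zero_mem _
    · obtain ⟨a, -, ha⟩ := hcover y _ subset_rfl hy
      exact Submodule.mem_iSup_of_mem a ha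
  · refine quotient_of_map (B.coord a ∘ₗ P.subtype ∘ₗ (S a).subtype) _ ?_ ?_
    · ext y
      change B.repr y a = 0 ↔ (y : P) ∈ ⨆ b, ⨆ (_ : b < a), S b
      constructor
      · intro h0
        by_cases hy : (y : P) = 0
        · rw [hy]; exact Submodule.zero_mem _
        · obtain ⟨b, hb, hyb⟩ := hcover y _ subset_rfl hy
          refine Submodule.mem_iSup_of_mem b (Submodule.mem_iSup_of_mem ?_ hyb)
          have hb' := Finsupp.mem_support_iff.1 hb
          refine lt_of_le_of_ne (not_lt.1 fun h => hb' ((hS a y).1 y.2 b h)) ?_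
          rintro rfl
          exact hb' h0
      · intro hy
        have : (⨆ b, ⨆ (_ : b < a), S b) ≤ LinearMap.ker (B.coord a ∘ₗ P.subtype) := by
          refine iSup_le fun b => iSup_le fun hb z hz => ?_
          exact (hS b z).1 hz a hb
        exact this hy
    · infer_instance

/-- Over a principal ideal domain, the quotient by the kernel of a map with values in a free
submodule is free. -/
theorem quotient_of_map_le {R M F : Type*} [CommRing R] [IsDomain R] [IsPrincipalIdealRing R]
    [AddCommGroup M] [Module R M] [AddCommGroup F] [Module R F] (f : M →ₗ[R] F)
    (N : Submodule R M) (hN : LinearMap.ker f = N) (G : Submodule R F) (hG : LinearMap.range f ≤ G)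
    (h : Module.Free R G) : Module.Free R (M ⧸ N) := by
  refine quotient_of_map f N hN ?_
  have := submodule_of_pid ((LinearMap.range f).submoduleOf G)
  exact Module.Free.of_equiv (Submodule.submoduleOfEquivOfLe hG)

/-- **Pontryagin's criterion**: a countable module over a principal ideal domain in which every
finite set lies in a finitely generated submodule with torsion-free quotient is free. -/
theorem of_countable_of_exists_fg_le {R M : Type*} [CommRing R] [IsDomain R]
    [IsPrincipalIdealRing R] [AddCommGroup M] [Module R M] [Module.IsTorsionFree R M] [Countable M]
    (h : ∀ s : Finset M, ∃ N : Submodule R M, N.FG ∧ (s : Set M) ⊆ N ∧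
      ∀ (r : R) (y : M), r ≠ 0 → r • y ∈ N → y ∈ N) : Module.Free R M := by
  classical
  have h' : ∀ s : Finset M, ∃ t : Finset M, (s : Set M) ⊆ Submodule.span R (t : Set M) ∧
      ∀ (r : R) (y : M), r ≠ 0 → r • y ∈ Submodule.span R (t : Set M) →
        y ∈ Submodule.span R (t : Set M) := by
    intro s
    obtain ⟨N, ⟨t, rfl⟩, hs, hp⟩ := h s
    exact ⟨t, hs, hp⟩
  choose c hc hp using h'
  obtain ⟨g, hg⟩ := exists_surjective_nat M
  obtain ⟨N, hfg, hpure, hmono, hmem⟩ : ∃ N : ℕ → Submodule R M, (∀ n, (N n).FG) ∧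
      (∀ n (r : R) (y : M), r ≠ 0 → r • y ∈ N n → y ∈ N n) ∧ Monotone N ∧
      ∀ n, g n ∈ N (n + 1) := by
    let t : ℕ → Finset M := fun n => Nat.rec (c ∅) (fun n s => c (insert (g n) s)) n
    refine ⟨fun n => Submodule.span R (SetLike.coe (t n)), fun n => ⟨t n, rfl⟩, fun n => ?_,
      monotone_nat_of_le_succ fun n => Submodule.span_le.2 fun y hy => ?_, fun n => ?_⟩
    · cases n with
      | zero => exact hp _
      | succ n => exact hp _
    · exact hc (insert (g n) (t n)) (by simp [show y ∈ t n from hy])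
    · exact hc (insert (g n) (t n)) (by simp)
  refine of_wellFounded_filtration N ?_ fun n => ?_
  · rw [eq_top_iff]
    intro y _
    obtain ⟨n, rfl⟩ := hg y
    exact Submodule.mem_iSup_of_mem _ (hmem n)
  · set Q := ⨆ b, ⨆ (_ : b < n), N b with hQ
    have hpureQ : ∀ (r : R) (y : M), r ≠ 0 → r • y ∈ Q → y ∈ Q := by
      intro r y hr hy
      cases n with
      | zero =>
        have : Q = ⊥ := by simp [hQ]
        rw [this, Submodule.mem_bot] at hy ⊢
        exact (smul_eq_zero_iff_right hr).1 hy
      | succ n =>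
        have : Q = N n := by
          refine le_antisymm (iSup_le fun b => iSup_le fun hb => hmono (Nat.lt_succ_iff.1 hb)) ?_
          exact le_iSup₂_of_le n (Nat.lt_succ_self n) le_rfl
        rw [this] at hy ⊢
        exact hpure n r y hr hy
    have : Module.Finite R (N n) := Module.Finite.iff_fg.2 (hfg n)
    have : Module.IsTorsionFree R (N n ⧸ Q.submoduleOf (N n)) := by
      refine Module.IsTorsionFree.of_smul_eq_zero fun r z hz => ?_
      by_cases hr : r = 0
      · exact Or.inl hr
      · right
        induction z using Submodule.Quotient.induction_on with
        | H y =>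
          rw [← Submodule.Quotient.mk_smul, Submodule.Quotient.mk_eq_zero] at hz
          rw [Submodule.Quotient.mk_eq_zero]
          exact hpureQ r y hr hz
    infer_instance

end Module.Free

namespace FreeRing

section RationalFunctions

variable {X k : Type*} [CommRing k]

/-! ### Squaring a variable -/

open Classical in
/-- The endomorphism of `k[X]` that sends the variable `x` to `x ^ 2` and fixes all others. -/
noncomputable def polySqVar (k : Type*) [CommRing k] (x : X) :
    MvPolynomial X k →ₐ[k] MvPolynomial X k :=
  MvPolynomial.aeval fun y =>
    if y = x then MvPolynomial.X x ^ 2 else MvPolynomial.X y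

theorem polySqVar_X_self (x : X) :
    polySqVar k x (MvPolynomial.X x) = MvPolynomial.X x ^ 2 := by
  simp [polySqVar]

theorem polySqVar_X_of_ne {x y : X} (h : y ≠ x) :
    polySqVar k x (MvPolynomial.X y) = MvPolynomial.X y := by
  simp [polySqVar, h]

theorem polySqVar_C (x : X) (a : k) :
    polySqVar k x (MvPolynomial.C a) = MvPolynomial.C a :=
  (polySqVar k x).commutes a

theorem polySqVar_monomial (x : X) (d : X →₀ ℕ) (a : k) :
    polySqVar k x (MvPolynomial.monomial d a) =
      MvPolynomial.monomial (d + Finsupp.single x (d x)) a := by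
  classical
  induction d using Finsupp.induction_linear generalizing a with
  | zero => simp
  | add f g hf hg =>
    have h1 := MvPolynomial.monomial_mul (s := f) (s' := g) (a := a) (b := 1)
    rw [mul_one] at h1
    rw [← h1, map_mul, hf, hg, MvPolynomial.monomial_mul, mul_one]
    congr 1
    rw [Finsupp.add_apply, Finsupp.single_add]
    ac_rfl
  | single y n =>
    rw [← mul_one a, ← MvPolynomial.C_mul_monomial, ← MvPolynomial.X_pow_eq_monomial, map_mul,
      map_pow, polySqVar_C]
    by_cases h : y = x
    · subst h
      rw [polySqVar_X_self, ← pow_mul, MvPolynomial.X_pow_eq_monomial,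
        MvPolynomial.C_mul_monomial, Finsupp.single_eq_same, ← Finsupp.single_add, two_mul]
    · rw [polySqVar_X_of_ne h, MvPolynomial.X_pow_eq_monomial, MvPolynomial.C_mul_monomial,
        Finsupp.single_eq_of_ne (Ne.symm h), Finsupp.single_zero, add_zero]

theorem coeff_polySqVar (x : X) (d : X →₀ ℕ) (p : MvPolynomial X k) :
    (polySqVar k x p).coeff (d + Finsupp.single x (d x)) = p.coeff d := by
  classical
  have hinj : ∀ e : X →₀ ℕ, e + Finsupp.single x (e x) = d + Finsupp.single x (d x) → e = d := by
    intro e h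
    ext y
    have := DFunLike.congr_fun h y
    by_cases hy : y = x
    · subst hy
      simp at this
      omega
    · simpa [Finsupp.single_eq_of_ne hy] using this
  conv_lhs => rw [p.as_sum, map_sum, MvPolynomial.coeff_sum]
  simp_rw [polySqVar_monomial, MvPolynomial.coeff_monomial]
  rw [Finset.sum_eq_single d]
  · simp
  · intro e _ he
    rw [if_neg fun h => he (hinj e h)]
  · intro h
    simpa using h

theorem polySqVar_injective (x : X) : Function.Injective (polySqVar k x) := by
  intro p q h
  ext d
  rw [← coeff_polySqVar x, h, coeff_polySqVar]

theorem polySqVar_mem_supported [Nontrivial k] (x : X) {Z : Set X} {p : MvPolynomial X k}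
    (hp : p ∈ MvPolynomial.supported k Z) : polySqVar k x p ∈ MvPolynomial.supported k Z := by
  have : MvPolynomial.supported k Z ≤ (MvPolynomial.supported k Z).comap (polySqVar k x) := by
    refine Algebra.adjoin_le ?_
    rintro _ ⟨y, hy, rfl⟩
    change polySqVar k x (MvPolynomial.X y) ∈ MvPolynomial.supported k Z
    by_cases h : y = x
    · subst h
      rw [polySqVar_X_self]
      exact pow_mem (MvPolynomial.X_mem_supported.2 hy) 2
    · rw [polySqVar_X_of_ne h]
      exact MvPolynomial.X_mem_supported.2 hy
  exact this hp

theorem fractionRing_ringHom_ext {A : Type*} [CommRing A]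
    {f g : FractionRing (MvPolynomial X k) →+* A}
    (hC : ∀ a, f (algebraMap (MvPolynomial X k) _ (MvPolynomial.C a)) =
      g (algebraMap (MvPolynomial X k) _ (MvPolynomial.C a)))
    (hX : ∀ y, f (algebraMap (MvPolynomial X k) _ (MvPolynomial.X y)) =
      g (algebraMap (MvPolynomial X k) _ (MvPolynomial.X y))) :
    f = g :=
  IsLocalization.ringHom_ext (nonZeroDivisors (MvPolynomial X k))
    (MvPolynomial.ringHom_ext hC hX)

variable [IsDomain k]

/-! ### Fields of rational functions -/

/-- The field of rational functions in the variables from `Z`, inside the fraction field of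
`k[X]`. -/
noncomputable def ratSubfield (k : Type*) [CommRing k] [IsDomain k] (Z : Set X) :
    Subfield (FractionRing (MvPolynomial X k)) :=
  Subfield.closure (algebraMap (MvPolynomial X k) (FractionRing (MvPolynomial X k)) ''
    (MvPolynomial.supported k Z : Set (MvPolynomial X k)))

theorem algebraMap_mem_ratSubfield {Z : Set X} {p : MvPolynomial X k}
    (hp : p ∈ MvPolynomial.supported k Z) :
    algebraMap (MvPolynomial X k) (FractionRing (MvPolynomial X k)) p ∈ ratSubfield k Z :=
  Subfield.subset_closure ⟨p, hp, rfl⟩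

theorem exists_div_of_mem_ratSubfield {Z : Set X} {f : FractionRing (MvPolynomial X k)}
    (hf : f ∈ ratSubfield k Z) :
    ∃ p ∈ MvPolynomial.supported k Z, ∃ q ∈ MvPolynomial.supported k Z, q ≠ 0 ∧
      f = algebraMap (MvPolynomial X k) _ p / algebraMap (MvPolynomial X k) _ q := by
  have hcl : Subring.closure (algebraMap (MvPolynomial X k) (FractionRing (MvPolynomial X k)) ''
      (MvPolynomial.supported k Z : Set (MvPolynomial X k))) =
      (MvPolynomial.supported k Z).toSubring.map
        (algebraMap (MvPolynomial X k) (FractionRing (MvPolynomial X k))) :=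
    Subring.closure_eq ((MvPolynomial.supported k Z).toSubring.map _)
  rw [ratSubfield, Subfield.mem_closure_iff, hcl] at hf
  obtain ⟨_, ⟨p, hp, rfl⟩, _, ⟨q, hq, rfl⟩, rfl⟩ := hf
  by_cases hq0 : q = 0
  · refine ⟨0, zero_mem _, 1, one_mem _, one_ne_zero, ?_⟩
    simp [hq0]
  · exact ⟨p, hp, q, hq, hq0, rfl⟩

theorem ratSubfield_mono {Y Z : Set X} (h : Y ⊆ Z) : ratSubfield k Y ≤ ratSubfield k Z :=
  Subfield.closure_mono (Set.image_mono (MvPolynomial.supported_mono h))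

theorem ratSubfield_le {Z : Set X} {S : Subfield (FractionRing (MvPolynomial X k))}
    (hC : ∀ a, algebraMap (MvPolynomial X k) _ (MvPolynomial.C a) ∈ S)
    (hX : ∀ y ∈ Z, algebraMap (MvPolynomial X k) _ (MvPolynomial.X y) ∈ S) :
    ratSubfield k Z ≤ S := by
  rw [ratSubfield, Subfield.closure_le]
  rintro _ ⟨p, hp, rfl⟩
  change p ∈ Algebra.adjoin k _ at hp
  induction hp using Algebra.adjoin_induction with
  | mem x hx => obtain ⟨y, hy, rfl⟩ := hx; exact hX y hy
  | algebraMap r => exact hC r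
  | add x y _ _ hx hy => rw [map_add]; exact add_mem hx hy
  | mul x y _ _ hx hy => rw [map_mul]; exact mul_mem hx hy

theorem algebraMap_X_mem_ratSubfield {Z : Set X} {y : X} (hy : y ∈ Z) :
    algebraMap (MvPolynomial X k) (FractionRing (MvPolynomial X k)) (MvPolynomial.X y) ∈
      ratSubfield k Z :=
  algebraMap_mem_ratSubfield (MvPolynomial.X_mem_supported.2 hy)

theorem algebraMap_C_mem_ratSubfield (Z : Set X) (a : k) :
    algebraMap (MvPolynomial X k) (FractionRing (MvPolynomial X k)) (MvPolynomial.C a) ∈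
      ratSubfield k Z :=
  algebraMap_mem_ratSubfield ((MvPolynomial.supported k Z).algebraMap_mem a)

/-- The endomorphism of the field of rational functions that sends the variable `x` to `x ^ 2`
and fixes all others. -/
noncomputable def sqVar (k : Type*) [CommRing k] [IsDomain k] (x : X) :
    FractionRing (MvPolynomial X k) →+* FractionRing (MvPolynomial X k) :=
  IsFractionRing.lift (g := (algebraMap (MvPolynomial X k) _).comp (polySqVar k x).toRingHom)
    ((IsFractionRing.injective _ _).comp (polySqVar_injective x))

theorem sqVar_algebraMap (x : X) (p : MvPolynomial X k) :
    sqVar k x (algebraMap (MvPolynomial X k) _ p) =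
      algebraMap (MvPolynomial X k) _ (polySqVar k x p) :=
  IsFractionRing.lift_algebraMap _ _

theorem sqVar_mem_ratSubfield (x : X) {Z : Set X} {f : FractionRing (MvPolynomial X k)}
    (hf : f ∈ ratSubfield k Z) : sqVar k x f ∈ ratSubfield k Z := by
  obtain ⟨p, hp, q, hq, -, rfl⟩ := exists_div_of_mem_ratSubfield hf
  rw [map_div₀, sqVar_algebraMap, sqVar_algebraMap]
  exact div_mem (algebraMap_mem_ratSubfield (polySqVar_mem_supported x hp))
    (algebraMap_mem_ratSubfield (polySqVar_mem_supported x hq))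

theorem sqVar_eq_self {x : X} {Z : Set X} (hx : x ∉ Z) {f : FractionRing (MvPolynomial X k)}
    (hf : f ∈ ratSubfield k Z) : sqVar k x f = f := by
  have : ratSubfield k Z ≤ RingHom.eqLocusField (sqVar k x) (RingHom.id _) := by
    refine ratSubfield_le (fun a => ?_) fun y hy => ?_
    · change sqVar k x _ = _
      rw [sqVar_algebraMap, polySqVar_C]; rfl
    · change sqVar k x _ = _
      rw [sqVar_algebraMap, polySqVar_X_of_ne (ne_of_mem_of_not_mem hy hx)]; rfl
  exact this hf

/-! ### Expansion as a Laurent series in one of the variables -/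

/-- Mapping the coefficients of a Laurent series along a ring homomorphism. -/
noncomputable def laurentMap {A B : Type*} [CommRing A] [CommRing B] (φ : A →+* B) :
    LaurentSeries A →+* LaurentSeries B where
  toFun f := f.map φ
  map_zero' := by ext; simp
  map_one' := HahnSeries.map_one φ.toMonoidWithZeroHom
  map_add' f g := by ext; simp
  map_mul' f g := HahnSeries.map_mul φ.toNonUnitalRingHom

theorem laurentMap_coeff {A B : Type*} [CommRing A] [CommRing B] (φ : A →+* B)
    (f : LaurentSeries A) (n : ℤ) : (laurentMap φ f).coeff n = φ (f.coeff n) := rfl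

theorem laurentMap_single {A B : Type*} [CommRing A] [CommRing B] (φ : A →+* B)
    (n : ℤ) (a : A) : laurentMap φ (HahnSeries.single n a) = HahnSeries.single n (φ a) := by
  ext m
  rw [laurentMap_coeff, HahnSeries.coeff_single, HahnSeries.coeff_single]
  split_ifs <;> simp

open Classical in
/-- The ring homomorphism from `k[X]` to polynomials in a new variable that sends `x` to the new
variable and treats the other variables as constants. -/
noncomputable def toPolynomialIn (k : Type*) [CommRing k] [IsDomain k] (x : X) :
    MvPolynomial X k →+* Polynomial (FractionRing (MvPolynomial X k)) :=
  MvPolynomial.eval₂Hom (Polynomial.C.comp ((algebraMap (MvPolynomial X k) _).comp MvPolynomial.C))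
    fun y => if y = x then Polynomial.X
      else Polynomial.C (algebraMap (MvPolynomial X k) _ (MvPolynomial.X y))

theorem toPolynomialIn_injective (x : X) : Function.Injective (toPolynomialIn k x) := by
  have h : (Polynomial.evalRingHom (algebraMap (MvPolynomial X k) (FractionRing (MvPolynomial X k))
      (MvPolynomial.X x))).comp (toPolynomialIn k x) = algebraMap (MvPolynomial X k) _ := by
    refine MvPolynomial.ringHom_ext (fun a => ?_) fun y => ?_
    · simp [toPolynomialIn]
    · by_cases hy : y = x
      · simp [toPolynomialIn, hy]
      · simp [toPolynomialIn, hy]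
  have h2 : Function.Injective ((Polynomial.evalRingHom (algebraMap (MvPolynomial X k)
      (FractionRing (MvPolynomial X k)) (MvPolynomial.X x))).comp (toPolynomialIn k x)) := by
    rw [h]
    exact IsFractionRing.injective _ _
  exact Function.Injective.of_comp h2

/-- The expansion of a polynomial as a Laurent series in the variable `x`. -/
noncomputable def polyLaurentExp (k : Type*) [CommRing k] [IsDomain k] (x : X) :
    MvPolynomial X k →+* LaurentSeries (FractionRing (MvPolynomial X k)) :=
  ((HahnSeries.ofPowerSeries ℤ _).comp Polynomial.coeToPowerSeries.ringHom).comp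
    (toPolynomialIn k x)

theorem polyLaurentExp_injective (x : X) : Function.Injective (polyLaurentExp k x) :=
  (HahnSeries.ofPowerSeries_injective.comp (Polynomial.coe_injective _)).comp
    (toPolynomialIn_injective x)

/-- The expansion of a rational function as a Laurent series in the variable `x`. -/
noncomputable def laurentExp (k : Type*) [CommRing k] [IsDomain k] (x : X) :
    FractionRing (MvPolynomial X k) →+* LaurentSeries (FractionRing (MvPolynomial X k)) :=
  IsFractionRing.lift (polyLaurentExp_injective x)

theorem laurentExp_C (x : X) (a : k) :
    laurentExp k x (algebraMap (MvPolynomial X k) _ (MvPolynomial.C a)) =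
      HahnSeries.single 0 (algebraMap (MvPolynomial X k) _ (MvPolynomial.C a)) := by
  rw [laurentExp, IsFractionRing.lift_algebraMap]
  simp [polyLaurentExp, toPolynomialIn]

theorem laurentExp_X_self (x : X) :
    laurentExp k x (algebraMap (MvPolynomial X k) _ (MvPolynomial.X x)) =
      HahnSeries.single 1 1 := by
  rw [laurentExp, IsFractionRing.lift_algebraMap]
  simp [polyLaurentExp, toPolynomialIn]

theorem laurentExp_X_of_ne {x y : X} (h : y ≠ x) :
    laurentExp k x (algebraMap (MvPolynomial X k) _ (MvPolynomial.X y)) =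
      HahnSeries.single 0 (algebraMap (MvPolynomial X k) _ (MvPolynomial.X y)) := by
  rw [laurentExp, IsFractionRing.lift_algebraMap]
  simp [polyLaurentExp, toPolynomialIn, h]

theorem laurentExp_of_notMem {x : X} {Z : Set X} (hx : x ∉ Z)
    {f : FractionRing (MvPolynomial X k)} (hf : f ∈ ratSubfield k Z) :
    laurentExp k x f = HahnSeries.single 0 f := by
  have : ratSubfield k Z ≤ RingHom.eqLocusField (laurentExp k x) HahnSeries.C :=
    ratSubfield_le (fun a => laurentExp_C x a)
      fun y hy => laurentExp_X_of_ne fun h => hx (h ▸ hy)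
  exact this hf

theorem laurentExp_coeff_mem (x : X) {Z : Set X}
    {f : FractionRing (MvPolynomial X k)} (hf : f ∈ ratSubfield k Z) (n : ℤ) :
    (laurentExp k x f).coeff n ∈ ratSubfield k (Z \ {x}) := by
  set S := ratSubfield k (Z \ {x}) with hS
  have : ratSubfield k Z ≤ (laurentMap S.subtype).fieldRange.comap (laurentExp k x) := by
    refine ratSubfield_le (fun a => ?_) fun y hy => ?_
    · rw [Subfield.mem_comap, laurentExp_C]
      exact ⟨HahnSeries.single 0 ⟨_, algebraMap_C_mem_ratSubfield _ a⟩, laurentMap_single _ _ _⟩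
    · rw [Subfield.mem_comap]
      by_cases h : y = x
      · subst h
        rw [laurentExp_X_self]
        exact ⟨HahnSeries.single 1 1, by rw [laurentMap_single, map_one]⟩
      · rw [laurentExp_X_of_ne h]
        exact ⟨HahnSeries.single 0 ⟨_, algebraMap_X_mem_ratSubfield ⟨hy, h⟩⟩,
          laurentMap_single _ _ _⟩
  obtain ⟨g, hg⟩ := this hf
  rw [← hg, laurentMap_coeff]
  exact (g.coeff n).2

/-- The constant term of the Laurent expansion in the variable `x`. -/
noncomputable def constTerm (k : Type*) [CommRing k] [IsDomain k] (x : X) :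
    FractionRing (MvPolynomial X k) →+ FractionRing (MvPolynomial X k) where
  toFun f := (laurentExp k x f).coeff 0
  map_zero' := by simp
  map_add' f g := by simp

theorem constTerm_mem (x : X) {Z : Set X} {f : FractionRing (MvPolynomial X k)}
    (hf : f ∈ ratSubfield k Z) : constTerm k x f ∈ ratSubfield k (Z \ {x}) :=
  laurentExp_coeff_mem x hf 0

theorem constTerm_of_notMem {x : X} {Z : Set X} (hx : x ∉ Z)
    {f : FractionRing (MvPolynomial X k)} (hf : f ∈ ratSubfield k Z) :
    constTerm k x f = f := by
  change (laurentExp k x f).coeff 0 = f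
  rw [laurentExp_of_notMem hx hf, HahnSeries.coeff_single_same]

theorem constTerm_sqVar {x y : X} (h : y ≠ x) (f : FractionRing (MvPolynomial X k)) :
    constTerm k x (sqVar k y f) = sqVar k y (constTerm k x f) := by
  have : (laurentExp k x).comp (sqVar k y) =
      (laurentMap (sqVar k y)).comp (laurentExp k x) := by
    refine fractionRing_ringHom_ext (fun a => ?_) fun z => ?_
    · simp only [RingHom.comp_apply]
      rw [sqVar_algebraMap, polySqVar_C, laurentExp_C, laurentMap_single, sqVar_algebraMap,
        polySqVar_C]
    · simp only [RingHom.comp_apply]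
      rw [sqVar_algebraMap]
      by_cases hz : z = x
      · subst hz
        rw [polySqVar_X_of_ne h.symm, laurentExp_X_self, laurentMap_single,
          (sqVar k y).map_one]
      · rw [laurentExp_X_of_ne hz, laurentMap_single, sqVar_algebraMap]
        by_cases hy : z = y
        · subst hy
          rw [polySqVar_X_self, map_pow, map_pow, laurentExp_X_of_ne hz, HahnSeries.single_pow]
          simp
        · rw [polySqVar_X_of_ne hy, laurentExp_X_of_ne hz]
  change (laurentExp k x (sqVar k y f)).coeff 0 = _
  rw [← RingHom.comp_apply, this, RingHom.comp_apply, laurentMap_coeff]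
  rfl

theorem mem_ratSubfield_diff_of_sqVar_eq {x : X} {Z : Set X}
    {f : FractionRing (MvPolynomial X k)} (hf : f ∈ ratSubfield k Z) (hx : sqVar k x f = f) :
    f ∈ ratSubfield k (Z \ {x}) := by
  let e : LaurentSeries (FractionRing (MvPolynomial X k)) →+*
      LaurentSeries (FractionRing (MvPolynomial X k)) :=
    HahnSeries.embDomainRingHom (AddMonoidHom.mulLeft (2 : ℤ))
      (fun a b h => by simpa using h) (fun a b => by simp)
  have hcomp : (laurentExp k x).comp (sqVar k x) = e.comp (laurentExp k x) := by
    refine fractionRing_ringHom_ext (fun a => ?_) fun z => ?_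
    · simp only [RingHom.comp_apply]
      rw [sqVar_algebraMap, polySqVar_C, laurentExp_C]
      exact HahnSeries.embDomainRingHom_C.symm
    · simp only [RingHom.comp_apply]
      rw [sqVar_algebraMap]
      by_cases hz : z = x
      · subst hz
        rw [polySqVar_X_self, map_pow, map_pow, laurentExp_X_self, HahnSeries.single_pow]
        refine Eq.trans ?_ HahnSeries.embDomain_single.symm
        simp
      · rw [polySqVar_X_of_ne hz, laurentExp_X_of_ne hz]
        exact HahnSeries.embDomainRingHom_C.symm
  have he : e (laurentExp k x f) = laurentExp k x f := by
    rw [← RingHom.comp_apply, ← hcomp, RingHom.comp_apply, hx]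
  have heven : ∀ n : ℤ, (laurentExp k x f).coeff (2 * n) = (laurentExp k x f).coeff n := by
    intro n
    conv_lhs => rw [← he]
    exact HahnSeries.embDomain_coeff
  have hodd : ∀ n : ℤ, ¬ (2 ∣ n) → (laurentExp k x f).coeff n = 0 := by
    intro n hn
    rw [← he]
    refine HahnSeries.embDomain_of_notMem_range ?_
    rintro ⟨m, rfl⟩
    exact hn ⟨m, rfl⟩
  have hzero : ∀ N : ℕ, ∀ n : ℤ, n.natAbs ≤ N → n ≠ 0 → (laurentExp k x f).coeff n = 0 := by
    intro N
    induction N with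
    | zero => intro n h1 h2; omega
    | succ N ih =>
      intro n h1 h2
      by_cases hn : 2 ∣ n
      · obtain ⟨m, rfl⟩ := hn
        rw [heven]
        exact ih m (by omega) (by omega)
      · exact hodd n hn
  have hexp : laurentExp k x f = laurentExp k x (constTerm k x f) := by
    rw [laurentExp_of_notMem (Z := Z \ {x}) (by simp) (constTerm_mem x hf)]
    ext n
    by_cases hn : n = 0
    · subst hn
      rw [HahnSeries.coeff_single_same]; rfl
    · rw [HahnSeries.coeff_single_of_ne hn, hzero _ n le_rfl hn]
  rw [(laurentExp k x).injective hexp]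
  exact constTerm_mem x hf

end RationalFunctions

end FreeRing

namespace FreeRing

open MvPolynomial

variable {X : Type*}

/-! ### Primitive polynomials -/

theorem NotIntDivisible.ne_zero {q : MvPolynomial X ℤ} (hq : NotIntDivisible q) : q ≠ 0 := by
  rintro rfl
  have := hq 2 (dvd_zero _)
  rw [Int.isUnit_iff] at this
  omega

theorem notIntDivisible_one : NotIntDivisible (1 : MvPolynomial X ℤ) := by
  intro m hm
  have := (C_dvd_iff_dvd_coeff m 1).1 hm 0
  rw [coeff_zero_one] at this
  exact isUnit_of_dvd_one this

theorem NotIntDivisible.C_dvd_of_dvd_mul {q : MvPolynomial X ℤ} (hq : NotIntDivisible q) {m : ℤ}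
    (hm : m ≠ 0) {a : MvPolynomial X ℤ} (h : C m ∣ a * q) : C m ∣ a := by
  induction m using UniqueFactorizationMonoid.induction_on_prime generalizing a with
  | h₁ => exact absurd rfl hm
  | h₂ u hu => exact (hu.map C).dvd
  | h₃ m p hm0 hp ih =>
    have hpC : Prime (C p : MvPolynomial X ℤ) := (prime_C_iff _).2 hp
    rw [C_mul] at h
    rcases hpC.dvd_or_dvd ((dvd_mul_right _ _).trans h) with ⟨b, rfl⟩ | h2
    · rw [C_mul]
      rw [mul_assoc] at h
      exact mul_dvd_mul_left _ (ih hm0 ((mul_dvd_mul_iff_left hpC.ne_zero).1 h))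
    · exact absurd (hq p h2) hp.not_isUnit

theorem NotIntDivisible.mul {q r : MvPolynomial X ℤ} (hq : NotIntDivisible q)
    (hr : NotIntDivisible r) : NotIntDivisible (q * r) := by
  intro m hm
  refine hq m (hr.C_dvd_of_dvd_mul ?_ hm)
  rintro rfl
  rw [C_0, zero_dvd_iff] at hm
  exact mul_ne_zero hq.ne_zero hr.ne_zero hm

theorem mem_supported_of_C_mul {Z : Set X} {m : ℤ} (hm : m ≠ 0) {p : MvPolynomial X ℤ}
    (h : C m * p ∈ supported ℤ Z) : p ∈ supported ℤ Z := by
  rw [mem_supported] at h ⊢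
  rwa [vars_C_mul _ hm] at h

theorem exists_eq_C_mul_notIntDivisible {Z : Set X} {b : MvPolynomial X ℤ} (hb : b ≠ 0)
    (hbZ : b ∈ supported ℤ Z) :
    ∃ m : ℤ, m ≠ 0 ∧ ∃ c ∈ supported ℤ Z, NotIntDivisible c ∧ b = C m * c := by
  set m := b.support.gcd (fun d => b.coeff d) with hm
  have hmb : C m ∣ b := by
    rw [C_dvd_iff_dvd_coeff]
    intro d
    by_cases hd : d ∈ b.support
    · exact Finset.gcd_dvd hd
    · rw [notMem_support_iff.1 hd]
      exact dvd_zero _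
  obtain ⟨c, hc⟩ := hmb
  have hm0 : m ≠ 0 := by
    rintro h
    rw [h, C_0, zero_mul] at hc
    exact hb hc
  refine ⟨m, hm0, c, mem_supported_of_C_mul hm0 (hc ▸ hbZ), ?_, hc⟩
  rintro n ⟨e, rfl⟩
  have h1 : m * n ∣ m := by
    conv_rhs => rw [hm]
    refine Finset.dvd_gcd fun d _ => ?_
    refine (C_dvd_iff_dvd_coeff (m * n) b).1 ⟨e, ?_⟩ d
    rw [hc, C_mul, mul_assoc]
  exact isUnit_of_dvd_one ((mul_dvd_mul_iff_left hm0).1 (by rwa [mul_one]))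

theorem NotIntDivisible.polySqVar {q : MvPolynomial X ℤ} (hq : NotIntDivisible q) (x : X) :
    NotIntDivisible (polySqVar ℤ x q) := by
  intro m hm
  refine hq m ((C_dvd_iff_dvd_coeff m q).2 fun d => ?_)
  rw [← coeff_polySqVar x]
  exact (C_dvd_iff_dvd_coeff _ _).1 hm _

/-! ### The groups `R Y` -/

theorem algebraMap_ne_zero {k : Type*} [CommRing k] [IsDomain k] {q : MvPolynomial X k}
    (hq : q ≠ 0) : algebraMap (MvPolynomial X k) (FractionRing (MvPolynomial X k)) q ≠ 0 :=
  (map_ne_zero_iff _ (IsFractionRing.injective _ _)).2 hq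

theorem div_eq_div_iff_algebraMap {k : Type*} [CommRing k] [IsDomain k]
    {a b q r : MvPolynomial X k} (hq : q ≠ 0) (hr : r ≠ 0) :
    algebraMap (MvPolynomial X k) (FractionRing (MvPolynomial X k)) a / algebraMap _ _ q =
      algebraMap _ _ b / algebraMap _ _ r ↔ a * r = b * q := by
  rw [div_eq_div_iff (algebraMap_ne_zero hq) (algebraMap_ne_zero hr), ← map_mul, ← map_mul]
  exact (IsFractionRing.injective _ _).eq_iff

theorem mem_R_iff {Z : Set X} {r : FractionRing (MvPolynomial X ℤ)} :
    r ∈ R Z ↔ ∃ p ∈ supported ℤ Z, ∃ q ∈ supported ℤ Z, NotIntDivisible q ∧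
      r = algebraMap _ _ p / algebraMap _ _ q := by
  refine ⟨fun h => ?_, fun h => AddSubgroup.subset_closure h⟩
  induction h using AddSubgroup.closure_induction with
  | mem r hr => exact hr
  | zero => exact ⟨0, zero_mem _, 1, one_mem _, notIntDivisible_one, by simp⟩
  | add r s _ _ hr hs =>
    obtain ⟨a, ha, q, hq, hqd, rfl⟩ := hr
    obtain ⟨b, hb, t, ht, htd, rfl⟩ := hs
    refine ⟨a * t + q * b, add_mem (mul_mem ha ht) (mul_mem hq hb), q * t, mul_mem hq ht,
      hqd.mul htd, ?_⟩
    rw [div_add_div _ _ (algebraMap_ne_zero hqd.ne_zero) (algebraMap_ne_zero htd.ne_zero)]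
    simp only [map_mul, map_add]
  | neg r _ hr =>
    obtain ⟨a, ha, q, hq, hqd, rfl⟩ := hr
    exact ⟨-a, neg_mem ha, q, hq, hqd, by rw [map_neg, neg_div]⟩

theorem R_le_ratSubfield (Z : Set X) : R Z ≤ (ratSubfield ℤ Z).toAddSubgroup := by
  intro r hr
  obtain ⟨a, ha, q, hq, -, rfl⟩ := mem_R_iff.1 hr
  exact (ratSubfield ℤ Z).div_mem (algebraMap_mem_ratSubfield ha) (algebraMap_mem_ratSubfield hq)

theorem exists_zsmul_mem_R {Z : Set X} {f : FractionRing (MvPolynomial X ℤ)}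
    (hf : f ∈ ratSubfield ℤ Z) : ∃ m : ℤ, m ≠ 0 ∧ m • f ∈ R Z := by
  obtain ⟨b, hb, c, hc, hc0, rfl⟩ := exists_div_of_mem_ratSubfield hf
  obtain ⟨m, hm, d, hd, hdd, rfl⟩ := exists_eq_C_mul_notIntDivisible hc0 hc
  refine ⟨m, hm, mem_R_iff.2 ⟨b, hb, d, hd, hdd, ?_⟩⟩
  rw [← smul_div_assoc, ← map_zsmul, div_eq_div_iff_algebraMap hc0 hdd.ne_zero, zsmul_eq_mul,
    ← eq_intCast (C : ℤ →+* MvPolynomial X ℤ)]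
  ring

theorem sqVar_mem_R (x : X) {Z : Set X} {r : FractionRing (MvPolynomial X ℤ)} (hr : r ∈ R Z) :
    sqVar ℤ x r ∈ R Z := by
  obtain ⟨a, ha, q, hq, hqd, rfl⟩ := mem_R_iff.1 hr
  rw [map_div₀, sqVar_algebraMap, sqVar_algebraMap]
  exact mem_R_iff.2 ⟨_, polySqVar_mem_supported x ha, _, polySqVar_mem_supported x hq,
    hqd.polySqVar x, rfl⟩

/-! ### Reduction modulo a prime -/

section Reduction

variable (p : ℕ) [Fact p.Prime]

/-- `IsReduction p Z r f` says that `r = a / q` is an element of `R Z` and that `f` is the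
reduction of this fraction modulo the prime number `p`. -/
def IsReduction (Z : Set X) (r : FractionRing (MvPolynomial X ℤ))
    (f : FractionRing (MvPolynomial X (ZMod p))) : Prop :=
  ∃ a ∈ supported ℤ Z, ∃ q ∈ supported ℤ Z, NotIntDivisible q ∧
    r = algebraMap _ _ a / algebraMap _ _ q ∧
    f = algebraMap (MvPolynomial X (ZMod p)) _ (MvPolynomial.map (Int.castRingHom (ZMod p)) a) /
      algebraMap (MvPolynomial X (ZMod p)) _ (MvPolynomial.map (Int.castRingHom (ZMod p)) q)

variable {p}

theorem map_castRingHom_eq_zero_iff (a : MvPolynomial X ℤ) :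
    MvPolynomial.map (Int.castRingHom (ZMod p)) a = 0 ↔ C (p : ℤ) ∣ a :=
  (C_dvd_iff_map_hom_eq_zero _ _ (fun r => by
    rw [eq_intCast, ZMod.intCast_zmod_eq_zero_iff_dvd]) a).symm

theorem NotIntDivisible.map_ne_zero {q : MvPolynomial X ℤ} (hq : NotIntDivisible q) :
    MvPolynomial.map (Int.castRingHom (ZMod p)) q ≠ 0 := by
  rw [Ne, map_castRingHom_eq_zero_iff]
  intro h
  exact (Nat.prime_iff_prime_int.1 (Fact.out : p.Prime)).not_isUnit (hq _ h)

theorem map_mem_supported {Z : Set X} {a : MvPolynomial X ℤ} (ha : a ∈ supported ℤ Z) :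
    MvPolynomial.map (Int.castRingHom (ZMod p)) a ∈ supported (ZMod p) Z := by
  classical
  rw [mem_supported] at ha ⊢
  exact (Finset.coe_subset.2 (vars_map _ _)).trans ha

theorem IsReduction.mono {Y Z : Set X} (h : Y ⊆ Z) {r : FractionRing (MvPolynomial X ℤ)}
    {f : FractionRing (MvPolynomial X (ZMod p))} (hr : IsReduction p Y r f) :
    IsReduction p Z r f := by
  obtain ⟨a, ha, q, hq, hqd, h1, h2⟩ := hr
  exact ⟨a, supported_mono h ha, q, supported_mono h hq, hqd, h1, h2⟩

theorem IsReduction.add {Z : Set X} {r s : FractionRing (MvPolynomial X ℤ)}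
    {f g : FractionRing (MvPolynomial X (ZMod p))} (hr : IsReduction p Z r f)
    (hs : IsReduction p Z s g) : IsReduction p Z (r + s) (f + g) := by
  obtain ⟨a, ha, q, hq, hqd, rfl, rfl⟩ := hr
  obtain ⟨b, hb, t, ht, htd, rfl, rfl⟩ := hs
  refine ⟨a * t + q * b, add_mem (mul_mem ha ht) (mul_mem hq hb), q * t, mul_mem hq ht,
    hqd.mul htd, ?_, ?_⟩
  · rw [div_add_div _ _ (algebraMap_ne_zero hqd.ne_zero) (algebraMap_ne_zero htd.ne_zero)]
    simp only [map_mul, map_add]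
  · rw [div_add_div _ _ (algebraMap_ne_zero hqd.map_ne_zero) (algebraMap_ne_zero htd.map_ne_zero)]
    simp only [map_mul, map_add]

theorem IsReduction.unique {Y Z : Set X} {r : FractionRing (MvPolynomial X ℤ)}
    {f g : FractionRing (MvPolynomial X (ZMod p))} (hf : IsReduction p Y r f)
    (hg : IsReduction p Z r g) : f = g := by
  obtain ⟨a, -, q, -, hqd, rfl, rfl⟩ := hf
  obtain ⟨b, -, t, -, htd, h, rfl⟩ := hg
  rw [div_eq_div_iff_algebraMap hqd.ne_zero htd.ne_zero] at h
  rw [div_eq_div_iff_algebraMap hqd.map_ne_zero htd.map_ne_zero, ← map_mul, ← map_mul, h]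

theorem exists_isReduction_of_mem_R {Z : Set X} {r : FractionRing (MvPolynomial X ℤ)}
    (hr : r ∈ R Z) : ∃ f ∈ ratSubfield (ZMod p) Z, IsReduction p Z r f := by
  obtain ⟨a, ha, q, hq, hqd, h⟩ := mem_R_iff.1 hr
  exact ⟨_, div_mem (algebraMap_mem_ratSubfield (map_mem_supported ha))
    (algebraMap_mem_ratSubfield (map_mem_supported hq)), a, ha, q, hq, hqd, h, rfl⟩

theorem exists_isReduction_of_mem_ratSubfield {Z : Set X}
    {f : FractionRing (MvPolynomial X (ZMod p))} (hf : f ∈ ratSubfield (ZMod p) Z) :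
    ∃ r ∈ R Z, IsReduction p Z r f := by
  have lift : ∀ b ∈ supported (ZMod p) Z, ∃ a ∈ supported ℤ Z,
      MvPolynomial.map (Int.castRingHom (ZMod p)) a = b := by
    intro b hb
    change b ∈ Algebra.adjoin _ _ at hb
    induction hb using Algebra.adjoin_induction with
    | mem x hx =>
      obtain ⟨y, hy, rfl⟩ := hx
      exact ⟨MvPolynomial.X y, X_mem_supported.2 hy, MvPolynomial.map_X _ _⟩
    | algebraMap c =>
      obtain ⟨n, rfl⟩ := ZMod.intCast_surjective c
      exact ⟨C n, (supported ℤ Z).algebraMap_mem n, MvPolynomial.map_C _ _⟩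
    | add x y _ _ hx hy =>
      obtain ⟨a, ha, rfl⟩ := hx
      obtain ⟨b, hb, rfl⟩ := hy
      exact ⟨a + b, add_mem ha hb, map_add _ _ _⟩
    | mul x y _ _ hx hy =>
      obtain ⟨a, ha, rfl⟩ := hx
      obtain ⟨b, hb, rfl⟩ := hy
      exact ⟨a * b, mul_mem ha hb, map_mul _ _ _⟩
  obtain ⟨a', ha', b', hb', hb0, rfl⟩ := exists_div_of_mem_ratSubfield hf
  obtain ⟨a, ha, rfl⟩ := lift a' ha'
  obtain ⟨b, hb, rfl⟩ := lift b' hb'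
  have hbne : b ≠ 0 := by
    rintro rfl
    exact hb0 (map_zero _)
  obtain ⟨m, hm, c, hc, hcd, rfl⟩ := exists_eq_C_mul_notIntDivisible hbne hb
  have hmp : (m : ZMod p) ≠ 0 := by
    intro h
    apply hb0
    rw [map_mul, map_C, eq_intCast, h, C_0, zero_mul]
  obtain ⟨n, hn⟩ := ZMod.intCast_surjective ((m : ZMod p)⁻¹)
  have hnm : C (n : ZMod p) * C (m : ZMod p) = (1 : MvPolynomial X (ZMod p)) := by
    rw [hn, ← C_mul, inv_mul_cancel₀ hmp, C_1]
  have hmem : C n * a ∈ supported ℤ Z := mul_mem ((supported ℤ Z).algebraMap_mem n) ha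
  refine ⟨_, mem_R_iff.2 ⟨C n * a, hmem, c, hc, hcd, rfl⟩, C n * a, hmem, c, hc, hcd, rfl, ?_⟩
  rw [div_eq_div_iff_algebraMap hb0 hcd.map_ne_zero]
  rw [map_mul, map_mul, MvPolynomial.map_C, MvPolynomial.map_C, eq_intCast, eq_intCast]
  linear_combination (-(MvPolynomial.map (Int.castRingHom (ZMod p)) a *
    MvPolynomial.map (Int.castRingHom (ZMod p)) c)) * hnm

theorem IsReduction.exists_eq_nsmul {Z : Set X} {r : FractionRing (MvPolynomial X ℤ)}
    (hr : IsReduction p Z r 0) : ∃ s ∈ R Z, r = p • s := by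
  obtain ⟨a, ha, q, hq, hqd, rfl, h⟩ := hr
  have h1 := (div_eq_zero_iff.1 h.symm).resolve_right (algebraMap_ne_zero hqd.map_ne_zero)
  have h2 : MvPolynomial.map (Int.castRingHom (ZMod p)) a = 0 := by
    by_contra h3
    exact algebraMap_ne_zero h3 h1
  obtain ⟨b, rfl⟩ := (map_castRingHom_eq_zero_iff a).1 h2
  have hp0 : (p : ℤ) ≠ 0 := by exact_mod_cast (Fact.out : p.Prime).ne_zero
  refine ⟨_, mem_R_iff.2 ⟨b, mem_supported_of_C_mul hp0 ha, q, hq, hqd, rfl⟩, ?_⟩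
  rw [← smul_div_assoc, ← map_nsmul, nsmul_eq_mul]
  simp

theorem isReduction_nsmul {Z : Set X} {r : FractionRing (MvPolynomial X ℤ)} (hr : r ∈ R Z) :
    IsReduction p Z (p • r) 0 := by
  obtain ⟨a, ha, q, hq, hqd, rfl⟩ := mem_R_iff.1 hr
  refine ⟨p • a, nsmul_mem ha p, q, hq, hqd, ?_, ?_⟩
  · rw [← smul_div_assoc, ← map_nsmul]
  · simp

end Reduction

end FreeRing

namespace FreeRing

open MvPolynomial

variable {X : Type*}

/-! ### Sums over faces -/

/-- The sum of the groups `G (V ∖ {x})` for `x` in the list `L`. -/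
def faces {A : Type*} [AddCommGroup A] (G : Set X → AddSubgroup A) (V : Set X) (L : List X) :
    AddSubgroup A :=
  ⨆ x ∈ L, G (V \ {x})

theorem faces_nil {A : Type*} [AddCommGroup A] (G : Set X → AddSubgroup A) (V : Set X) :
    faces G V [] = ⊥ := by
  simp [faces]

theorem faces_cons {A : Type*} [AddCommGroup A] (G : Set X → AddSubgroup A) (V : Set X) (x : X)
    (L : List X) : faces G V (x :: L) = G (V \ {x}) ⊔ faces G V L := by
  simp [faces, iSup_or, iSup_sup_eq]

theorem faces_le {A : Type*} [AddCommGroup A] {G : Set X → AddSubgroup A} {V : Set X} {L : List X}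
    {H : AddSubgroup A} (h : ∀ x ∈ L, G (V \ {x}) ≤ H) : faces G V L ≤ H :=
  iSup₂_le h

theorem le_faces {A : Type*} [AddCommGroup A] (G : Set X → AddSubgroup A) (V : Set X)
    {L : List X} {x : X} (hx : x ∈ L) : G (V \ {x}) ≤ faces G V L :=
  le_iSup₂_of_le x hx le_rfl

theorem faces_induction {A : Type*} [AddCommGroup A] {G : Set X → AddSubgroup A} {V : Set X}
    {L : List X} (P : A → Prop) (hG : ∀ x ∈ L, ∀ r ∈ G (V \ {x}), P r) (h0 : P 0)
    (hadd : ∀ r s, P r → P s → P (r + s)) {r : A} (hr : r ∈ faces G V L) : P r := by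
  rw [faces, iSup_subtype'] at hr
  exact AddSubgroup.iSup_induction (C := P) _ hr (fun x r hr => hG x x.2 r hr) h0 hadd

/-- The additive group of the field of rational functions in the variables from `Z`. -/
noncomputable def ratGroup (k : Type*) [CommRing k] [IsDomain k] (Z : Set X) :
    AddSubgroup (FractionRing (MvPolynomial X k)) :=
  (ratSubfield k Z).toAddSubgroup

theorem faces_R_mono {V W : Set X} (h : V ⊆ W) (L : List X) : faces R V L ≤ faces R W L :=
  faces_le fun _ hx => (R_mono (Set.sdiff_subset_sdiff_left h)).trans (le_faces R W hx)

section Torsion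

variable {p : ℕ} [Fact p.Prime]

theorem exists_isReduction_of_mem_faces {V : Set X} {L : List X}
    {r : FractionRing (MvPolynomial X ℤ)} (hr : r ∈ faces R V L) :
    ∃ f ∈ faces (ratGroup (ZMod p)) V L, IsReduction p V r f := by
  refine faces_induction (fun r => ∃ f ∈ faces (ratGroup (ZMod p)) V L, IsReduction p V r f)
    (fun x hx r hr => ?_) ?_ ?_ hr
  · obtain ⟨f, hf, hrf⟩ := exists_isReduction_of_mem_R (p := p) hr
    exact ⟨f, le_faces _ _ hx hf, hrf.mono Set.sdiff_subset⟩
  · exact ⟨0, zero_mem _, by simpa using isReduction_nsmul (p := p) (zero_mem (R V))⟩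
  · rintro r s ⟨f, hf, hrf⟩ ⟨g, hg, hsg⟩
    exact ⟨f + g, add_mem hf hg, hrf.add hsg⟩

theorem exists_mem_faces_isReduction {V : Set X} {L : List X}
    {f : FractionRing (MvPolynomial X (ZMod p))} (hf : f ∈ faces (ratGroup (ZMod p)) V L) :
    ∃ r ∈ faces R V L, IsReduction p V r f := by
  refine faces_induction (fun f => ∃ r ∈ faces R V L, IsReduction p V r f)
    (fun x hx f hf => ?_) ?_ ?_ hf
  · obtain ⟨r, hr, hrf⟩ := exists_isReduction_of_mem_ratSubfield (p := p) hf
    exact ⟨r, le_faces _ _ hx hr, hrf.mono Set.sdiff_subset⟩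
  · exact ⟨0, zero_mem _, by simpa using isReduction_nsmul (p := p) (zero_mem (R V))⟩
  · rintro f g ⟨r, hr, hrf⟩ ⟨s, hs, hsg⟩
    exact ⟨r + s, add_mem hr hs, hrf.add hsg⟩

theorem constTerm_mem_faces {k : Type*} [CommRing k] [IsDomain k] (x : X) {V : Set X} {L : List X}
    {f : FractionRing (MvPolynomial X k)} (hf : f ∈ faces (ratGroup k) V L) :
    constTerm k x f ∈ faces (ratGroup k) (V \ {x}) L := by
  refine faces_induction (fun f => constTerm k x f ∈ faces (ratGroup k) (V \ {x}) L)
    (fun y hy f hf => ?_) ?_ ?_ hf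
  · refine le_faces _ _ hy ?_
    rw [Set.sdiff_sdiff_comm]
    exact constTerm_mem x hf
  · rw [map_zero]
    exact zero_mem _
  · intro f g hf hg
    rw [map_add]
    exact add_mem hf hg

theorem mem_faces_of_prime_nsmul_mem (p : ℕ) [Fact p.Prime] {V : Set X} (L : List X)
    {r : FractionRing (MvPolynomial X ℤ)} (hr : r ∈ R V) (h : p • r ∈ faces R V L) :
    r ∈ faces R V L := by
  induction L generalizing r with
  | nil =>
    rw [faces_nil, AddSubgroup.mem_bot] at h ⊢
    exact (smul_eq_zero.1 h).resolve_left (Fact.out : p.Prime).ne_zero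
  | cons x L ih =>
    rw [faces_cons] at h
    obtain ⟨s, hs, t, ht, hst⟩ := AddSubgroup.mem_sup.1 h
    obtain ⟨f, hf, hsf⟩ := exists_isReduction_of_mem_R (p := p) hs
    obtain ⟨g, hg, htg⟩ := exists_isReduction_of_mem_faces (p := p) ht
    have hfg : f + g = 0 :=
      (((hsf.mono Set.sdiff_subset).add htg).unique (hst ▸ isReduction_nsmul hr))
    obtain ⟨u, hu, hug⟩ := exists_mem_faces_isReduction (constTerm_mem_faces x hg)
    have hsum : f + constTerm (ZMod p) x g = 0 := by
      have h1 := congrArg (constTerm (ZMod p) x) hfg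
      rwa [map_add, map_zero, constTerm_of_notMem (Z := V \ {x}) (by simp) hf] at h1
    have hred := hsf.add hug
    rw [hsum] at hred
    obtain ⟨v, hv, hv'⟩ := hred.exists_eq_nsmul
    have huV : u ∈ faces R V L := faces_R_mono Set.sdiff_subset L hu
    have key : r - v ∈ faces R V L := by
      refine ih (sub_mem hr (R_mono Set.sdiff_subset hv)) ?_
      have : p • (r - v) = t - u := by
        rw [nsmul_sub, ← hv', ← hst]
        abel
      rw [this]
      exact sub_mem ht huV
    rw [faces_cons]
    exact AddSubgroup.mem_sup.2 ⟨v, hv, r - v, key, by abel⟩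

end Torsion

theorem mem_faces_of_zsmul_mem {V : Set X} (L : List X) {r : FractionRing (MvPolynomial X ℤ)}
    (hr : r ∈ R V) {m : ℤ} (hm : m ≠ 0) (h : m • r ∈ faces R V L) : r ∈ faces R V L := by
  have hnat : ∀ n : ℕ, n ≠ 0 → ∀ r ∈ R V, n • r ∈ faces R V L → r ∈ faces R V L := by
    intro n
    induction n using Nat.recOnMul with
    | zero => exact fun h => absurd rfl h
    | one => intro _ r _ h; rwa [one_smul] at h
    | prime q hq =>
      intro _ r hr h
      have : Fact q.Prime := ⟨hq⟩
      exact mem_faces_of_prime_nsmul_mem q L hr h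
    | mul a b ha hb =>
      intro hab r hr h
      rw [mul_smul] at h
      have ha0 := left_ne_zero_of_mul hab
      have hb0 := right_ne_zero_of_mul hab
      exact hb hb0 r hr (ha ha0 _ (nsmul_mem hr b) h)
  refine hnat m.natAbs (by simpa using hm) r hr ?_
  rcases Int.natAbs_eq m with h' | h'
  · rw [h', natCast_zsmul] at h
    exact h
  · rw [h', neg_smul, natCast_zsmul, neg_mem_iff] at h
    exact h

/-! ### Iterated differences -/

/-- The composition of the differences `r ↦ r - sqVar x r` for `x` in the list `L`. -/
noncomputable def diffOp : List X →
    (FractionRing (MvPolynomial X ℤ) →+ FractionRing (MvPolynomial X ℤ))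
  | [] => AddMonoidHom.id _
  | x :: L => (AddMonoidHom.id _ - (sqVar ℤ x).toAddMonoidHom).comp (diffOp L)

theorem diffOp_cons (x : X) (L : List X) (r : FractionRing (MvPolynomial X ℤ)) :
    diffOp (x :: L) r = diffOp L r - sqVar ℤ x (diffOp L r) := rfl

theorem diffOp_mem_R (L : List X) {V : Set X} {r : FractionRing (MvPolynomial X ℤ)}
    (hr : r ∈ R V) : diffOp L r ∈ R V := by
  induction L with
  | nil => exact hr
  | cons x L ih => exact sub_mem ih (sqVar_mem_R x ih)

theorem diffOp_mem_ratSubfield (L : List X) {V : Set X} {r : FractionRing (MvPolynomial X ℤ)}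
    (hr : r ∈ ratSubfield ℤ V) : diffOp L r ∈ ratSubfield ℤ V := by
  induction L with
  | nil => exact hr
  | cons x L ih => exact sub_mem ih (sqVar_mem_ratSubfield x ih)

theorem diffOp_eq_zero {L : List X} {V : Set X} {x : X} (hx : x ∈ L) (hxV : x ∉ V)
    {r : FractionRing (MvPolynomial X ℤ)} (hr : r ∈ ratSubfield ℤ V) : diffOp L r = 0 := by
  induction L with
  | nil => simp at hx
  | cons y L ih =>
    rw [diffOp_cons]
    rcases List.mem_cons.1 hx with rfl | hx
    · rw [sqVar_eq_self hxV (diffOp_mem_ratSubfield L hr), sub_self]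
    · rw [ih hx, map_zero, sub_zero]

theorem constTerm_diffOp {L : List X} {x : X} (hx : x ∉ L)
    (r : FractionRing (MvPolynomial X ℤ)) :
    constTerm ℤ x (diffOp L r) = diffOp L (constTerm ℤ x r) := by
  induction L with
  | nil => rfl
  | cons y L ih =>
    rw [List.mem_cons, not_or] at hx
    rw [diffOp_cons, diffOp_cons, map_sub, constTerm_sqVar (Ne.symm hx.1), ih hx.2]

theorem mem_faces_ratGroup_of_diffOp_eq_zero {L : List X} (hL : L.Nodup) {V : Set X}
    {r : FractionRing (MvPolynomial X ℤ)} (hr : r ∈ ratSubfield ℤ V) (h : diffOp L r = 0) :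
    r ∈ faces (ratGroup ℤ) V L := by
  induction L generalizing r with
  | nil =>
    rw [faces_nil, AddSubgroup.mem_bot]
    exact h
  | cons x L ih =>
    rw [List.nodup_cons] at hL
    rw [diffOp_cons, sub_eq_zero] at h
    have hfix := mem_ratSubfield_diff_of_sqVar_eq (diffOp_mem_ratSubfield L hr) h.symm
    have hc := constTerm_of_notMem (x := x) (by simp) hfix
    rw [constTerm_diffOp hL.1] at hc
    have hmem := constTerm_mem x hr
    have key : r - constTerm ℤ x r ∈ faces (ratGroup ℤ) V L := by
      refine ih hL.2 (sub_mem hr (ratSubfield_mono Set.sdiff_subset hmem)) ?_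
      rw [map_sub, hc, sub_self]
    rw [faces_cons]
    exact AddSubgroup.mem_sup.2 ⟨_, hmem, _, key, by abel⟩

theorem diffOp_eq_zero_iff {L : List X} (hL : L.Nodup) {V : Set X}
    {r : FractionRing (MvPolynomial X ℤ)} (hr : r ∈ R V) :
    diffOp L r = 0 ↔ r ∈ faces R V L := by
  constructor
  · intro h
    have h1 := mem_faces_ratGroup_of_diffOp_eq_zero hL (R_le_ratSubfield V hr) h
    obtain ⟨m, hm, hmr⟩ : ∃ m : ℤ, m ≠ 0 ∧ m • r ∈ faces R V L := by
      refine faces_induction (fun r => ∃ m : ℤ, m ≠ 0 ∧ m • r ∈ faces R V L)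
        (fun x hx f hf => ?_) ⟨1, one_ne_zero, by simp⟩ ?_ h1
      · obtain ⟨m, hm, h⟩ := exists_zsmul_mem_R hf
        exact ⟨m, hm, le_faces R V hx h⟩
      · rintro f g ⟨m, hm, hf⟩ ⟨n, hn, hg⟩
        refine ⟨m * n, mul_ne_zero hm hn, ?_⟩
        rw [zsmul_add]
        refine add_mem ?_ ?_
        · rw [mul_comm, mul_smul]
          exact zsmul_mem hf n
        · rw [mul_smul]
          exact zsmul_mem hg m
    exact mem_faces_of_zsmul_mem L hr hm hmr
  · intro h
    have : faces R V L ≤ (diffOp L).ker :=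
      faces_le fun x hx f hf => diffOp_eq_zero hx (by simp) (R_le_ratSubfield _ hf)
    exact this h

/-- The quotient of an abelian group by the kernel of a homomorphism into a free abelian group is
free. -/
theorem free_quotient_of_ker {A B : Type*} [AddCommGroup A] [AddCommGroup B] (f : A →+ B)
    {N : AddSubgroup A} (hN : f.ker = N) {G : AddSubgroup B} (hG : ∀ a, f a ∈ G)
    (h : Module.Free ℤ G) : Module.Free ℤ (A ⧸ N) := by
  subst hN
  have hinj : Function.Injective (QuotientAddGroup.kerLift f) :=
    QuotientAddGroup.kerLift_injective f
  let g : (A ⧸ f.ker) →+ G := (QuotientAddGroup.kerLift f).codRestrict G (by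
    intro z
    induction z using QuotientAddGroup.induction_on with
    | H a => exact hG a)
  have hg : Function.Injective g.toIntLinearMap := fun a b hab => hinj (congrArg Subtype.val hab)
  have := Module.Free.submodule_of_pid (LinearMap.range g.toIntLinearMap)
  exact Module.Free.of_equiv (LinearEquiv.ofInjective _ hg).symm

/-- The quotient of `R V` by the sum of its faces embeds into `R V`. -/
theorem free_quotient_faces {L : List X} (hL : L.Nodup) (V : Set X) (h : Module.Free ℤ (R V)) :
    Module.Free ℤ (R V ⧸ (faces R V L).addSubgroupOf (R V)) := by
  refine free_quotient_of_ker ((diffOp L).comp (R V).subtype) ?_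
    (fun a => diffOp_mem_R L a.2) h
  ext a
  exact diffOp_eq_zero_iff hL a.2

end FreeRing

namespace FreeRing

open MvPolynomial

variable {X : Type*}

/-! ### Freeness of `R V` -/

theorem exists_finset_mem_R {V : Set X} {r : FractionRing (MvPolynomial X ℤ)} (hr : r ∈ R V) :
    ∃ s : Finset X, (s : Set X) ⊆ V ∧ r ∈ R (s : Set X) := by
  classical
  obtain ⟨a, ha, q, hq, hqd, rfl⟩ := mem_R_iff.1 hr
  refine ⟨a.vars ∪ q.vars, ?_, mem_R_iff.2 ⟨a, ?_, q, ?_, hqd, rfl⟩⟩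
  · rw [Finset.coe_union]
    exact Set.union_subset (mem_supported.1 ha) (mem_supported.1 hq)
  · rw [mem_supported, Finset.coe_union]
    exact Set.subset_union_left
  · rw [mem_supported, Finset.coe_union]
    exact Set.subset_union_right

theorem countable_R {V : Set X} (hV : V.Countable) : Countable (R V) := by
  have : Countable V := hV
  have hpoly : Countable (MvPolynomial V ℤ) := by
    rw [← Cardinal.mk_le_aleph0_iff]
    refine cardinalMk_le_max_lift.trans ?_
    simp
  have hsupp : (supported ℤ V : Set (MvPolynomial X ℤ)).Countable := by
    rw [supported_eq_range_rename]
    exact Set.countable_range _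
  refine Set.Countable.mono ?_ (hsupp.image2 hsupp fun p q =>
    algebraMap (MvPolynomial X ℤ) (FractionRing (MvPolynomial X ℤ)) p / algebraMap _ _ q)
  intro r hr
  obtain ⟨a, ha, q, hq, -, rfl⟩ := mem_R_iff.1 hr
  exact ⟨a, ha, q, hq, rfl⟩

open scoped Pointwise in
theorem exists_common_denominator {V : Set X} (s : Finset (R V)) :
    ∃ q ∈ supported ℤ V, NotIntDivisible q ∧ ∃ D : Finset (X →₀ ℕ), ∀ r ∈ s,
      ∃ a ∈ supported ℤ V, a.support ⊆ D ∧
        (r : FractionRing (MvPolynomial X ℤ)) = algebraMap _ _ a / algebraMap _ _ q := by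
  classical
  induction s using Finset.induction_on with
  | empty => exact ⟨1, one_mem _, notIntDivisible_one, ∅, by simp⟩
  | insert r s _ ih =>
    obtain ⟨q, hq, hqd, D, hD⟩ := ih
    obtain ⟨b, hb, t, ht, htd, hr⟩ := mem_R_iff.1 r.2
    refine ⟨q * t, mul_mem hq ht, hqd.mul htd, (b * q).support ∪ (D + t.support), ?_⟩
    intro u hu
    rcases Finset.mem_insert.1 hu with rfl | hu
    · refine ⟨b * q, mul_mem hb hq, Finset.subset_union_left, ?_⟩
      rw [hr, div_eq_div_iff_algebraMap htd.ne_zero (hqd.mul htd).ne_zero]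
      ring
    · obtain ⟨a, ha, haD, hau⟩ := hD u hu
      refine ⟨a * t, mul_mem ha ht, ?_, ?_⟩
      · exact (support_mul a t).trans ((Finset.add_subset_add_right haD).trans
          Finset.subset_union_right)
      · rw [hau, div_eq_div_iff_algebraMap hqd.ne_zero (hqd.mul htd).ne_zero]
        ring

theorem free_R_of_countable {V : Set X} (hV : V.Countable) : Module.Free ℤ (R V) := by
  have := countable_R hV
  refine Module.Free.of_countable_of_exists_fg_le fun s => ?_
  obtain ⟨q, hq, hqd, D, hD⟩ := exists_common_denominator s
  let P : Submodule ℤ (MvPolynomial X ℤ) :=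
    Submodule.span ℤ ((fun d => monomial d (1 : ℤ)) '' (D : Set (X →₀ ℕ)))
  have hP : ∀ a : MvPolynomial X ℤ, a.support ⊆ D → a ∈ P := by
    intro a ha
    rw [a.as_sum]
    refine Submodule.sum_mem _ fun d hd => ?_
    have : monomial d (a.coeff d) = a.coeff d • monomial d (1 : ℤ) := by
      rw [smul_monomial, smul_eq_mul, mul_one]
    rw [this]
    exact P.smul_mem _ (Submodule.subset_span ⟨d, ha hd, rfl⟩)
  have hPsupp : ∀ a ∈ P, a.support ⊆ D := by
    intro a ha
    induction ha using Submodule.span_induction with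
    | mem a ha =>
      obtain ⟨d, hd, rfl⟩ := ha
      exact support_monomial_subset.trans (by simpa using hd)
    | zero => simp
    | add a b _ _ ha hb =>
      classical
      exact support_add.trans (Finset.union_subset ha hb)
    | smul n a _ ha => exact support_smul.trans ha
  let f : MvPolynomial X ℤ →ₗ[ℤ] FractionRing (MvPolynomial X ℤ) :=
    ((AddMonoidHom.mulRight (algebraMap (MvPolynomial X ℤ) _ q)⁻¹).comp
      (algebraMap (MvPolynomial X ℤ) _).toAddMonoidHom).toIntLinearMap
  have hf : ∀ a, f a = algebraMap _ _ a / algebraMap _ _ q := fun a => by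
    rw [div_eq_mul_inv]
    rfl
  let N : Submodule ℤ (R V) := (P.map f).comap (R V).subtype.toIntLinearMap
  have hmemN : ∀ r : R V, r ∈ N ↔ ∃ a : MvPolynomial X ℤ, a.support ⊆ D ∧
      (r : FractionRing (MvPolynomial X ℤ)) = algebraMap _ _ a / algebraMap _ _ q := by
    intro r
    constructor
    · rintro ⟨a, ha, har⟩
      exact ⟨a, hPsupp a ha, by rw [← hf, har]; rfl⟩
    · rintro ⟨a, ha, har⟩
      exact ⟨a, hP a ha, by rw [hf, ← har]; rfl⟩
  refine ⟨N, ?_, ?_, ?_⟩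
  · have hPfg : P.FG := Submodule.fg_span (D.finite_toSet.image _)
    have hnoeth : IsNoetherian ℤ (P.map f) := isNoetherian_of_fg_of_noetherian _ (hPfg.map f)
    let g : N →ₗ[ℤ] P.map f :=
      (R V).subtype.toIntLinearMap.restrict (p := N) (q := P.map f) fun r hr => hr
    have hg : Function.Injective g := fun a b hab =>
      Subtype.ext (Subtype.ext (congrArg (P.map f).subtype hab))
    exact Module.Finite.iff_fg.1 (Module.Finite.of_injective g hg)
  · intro r hr
    obtain ⟨a, -, ha, h⟩ := hD r hr
    exact (hmemN r).2 ⟨a, ha, h⟩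
  · intro m r hm hr
    rw [hmemN] at hr ⊢
    obtain ⟨a, haD, ha⟩ := hr
    obtain ⟨b, -, t, -, htd, hbt⟩ := mem_R_iff.1 r.2
    have h1 : C m * b * q = a * t := by
      rw [← div_eq_div_iff_algebraMap htd.ne_zero hqd.ne_zero, ← ha, map_mul, mul_div_assoc,
        ← hbt, AddSubgroup.coe_zsmul, zsmul_eq_mul]
      simp
    obtain ⟨e, rfl⟩ : C m ∣ a := htd.C_dvd_of_dvd_mul hm ⟨b * q, by rw [← h1]; ring⟩
    refine ⟨e, fun d hd => haD ?_, ?_⟩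
    · rw [mem_support_iff] at hd ⊢
      rw [coeff_C_mul]
      exact mul_ne_zero hm hd
    · rw [hbt, div_eq_div_iff_algebraMap htd.ne_zero hqd.ne_zero]
      have hC : (C m : MvPolynomial X ℤ) ≠ 0 := by simpa using hm
      exact mul_left_cancel₀ hC (by rw [← mul_assoc, h1, mul_assoc])

/-- The group `R V` is a free abelian group, for every set `V` of variables. -/
theorem free_R (V : Set X) : Module.Free ℤ (R V) := by
  classical
  induction hκ : Cardinal.mk V using WellFoundedLT.induction generalizing V with
  | ind κ ih =>
  subst hκ
  by_cases hV : V.Countable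
  · exact free_R_of_countable hV
  have hinf : Cardinal.aleph0 ≤ Cardinal.mk V := by
    rw [← Set.countable_coe_iff, ← Cardinal.mk_le_aleph0_iff, not_le] at hV
    exact hV.le
  obtain ⟨_, _, hord⟩ := Cardinal.exists_ord_eq_type_lt V
  have hcard : ∀ a : V, Cardinal.mk (Subtype.val '' Set.Iic a : Set X) < Cardinal.mk V := by
    intro a
    rw [Cardinal.mk_image_eq Subtype.val_injective, ← Set.Iio_insert]
    exact (Cardinal.mk_insert_le).trans_lt
      (Cardinal.add_lt_of_lt hinf (Cardinal.mk_Iio_lt a hord)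
        (Cardinal.one_lt_aleph0.trans_le hinf))
  have hfree : ∀ a : V, Module.Free ℤ (R (Subtype.val '' Set.Iic a : Set X)) :=
    fun a => ih _ (hcard a) _ rfl
  let N : V → Submodule ℤ (R V) := fun a =>
    AddSubgroup.toIntSubmodule ((R (Subtype.val '' Set.Iic a : Set X)).addSubgroupOf (R V))
  have hcover : ∀ (S : Set V), S.Nonempty → ∀ r : R V,
      (r : FractionRing (MvPolynomial X ℤ)) ∈ R (Subtype.val '' S : Set X) → ∃ b ∈ S, r ∈ N b := by
    intro S hS r hr
    obtain ⟨s, hsS, hs⟩ := exists_finset_mem_R hr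
    obtain ⟨T, hTS, rfl⟩ := Finset.subset_set_image_iff.1 hsS
    obtain ⟨b, hb, hTb⟩ : ∃ b ∈ S, ∀ c ∈ T, c ≤ b := by
      rcases T.eq_empty_or_nonempty with rfl | hT
      · obtain ⟨b, hb⟩ := hS
        exact ⟨b, hb, by simp⟩
      · exact ⟨T.max' hT, hTS (T.max'_mem hT), fun c hc => T.le_max' c hc⟩
    refine ⟨b, hb, R_mono ?_ hs⟩
    rw [Finset.coe_image]
    exact Set.image_mono hTb
  refine Module.Free.of_wellFounded_filtration N ?_ fun a => ?_
  · rw [eq_top_iff]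
    intro r _
    have hne : Nonempty V :=
      Cardinal.mk_ne_zero_iff.1 (Cardinal.aleph0_pos.trans_le hinf).ne'
    obtain ⟨b, -, hb⟩ := hcover Set.univ Set.univ_nonempty r (by simp)
    exact Submodule.mem_iSup_of_mem b hb
  · let j : N a →ₗ[ℤ] FractionRing (MvPolynomial X ℤ) :=
      (R V).subtype.toIntLinearMap ∘ₗ (N a).subtype
    have hj : ∀ r, j r ∈ R (Subtype.val '' Set.Iic a : Set X) := fun r => r.2
    rcases (Set.Iio a).eq_empty_or_nonempty with hmin | hne
    · refine Module.Free.quotient_of_map_le j _ ?_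
        (AddSubgroup.toIntSubmodule (R (Subtype.val '' Set.Iic a : Set X))) ?_ (hfree a)
      · have hbot : (⨆ b, ⨆ (_ : b < a), N b) = ⊥ := by
          refine le_bot_iff.1 (iSup_le fun b => iSup_le fun hb => ?_)
          exact absurd (show b ∈ Set.Iio a from hb) (by simp [hmin])
        rw [hbot, LinearMap.ker_eq_bot.2 (Subtype.val_injective.comp Subtype.val_injective)]
        ext r
        simp [Submodule.submoduleOf]
      · rintro _ ⟨r, rfl⟩
        exact hj r
    · refine Module.Free.quotient_of_map_le ((diffOp [(a : X)]).toIntLinearMap ∘ₗ j) _ ?_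
        (AddSubgroup.toIntSubmodule (R (Subtype.val '' Set.Iic a : Set X))) ?_ (hfree a)
      · ext r
        have hdiff : (Subtype.val '' Set.Iic a : Set X) \ {(a : X)} = Subtype.val '' Set.Iio a := by
          rw [← Set.image_singleton, ← Set.image_sdiff Subtype.val_injective, Set.Iic_sdiff_right]
        change diffOp [(a : X)] (j r) = 0 ↔ (r : R V) ∈ ⨆ b, ⨆ (_ : b < a), N b
        rw [diffOp_eq_zero_iff (List.nodup_singleton _) (hj r), faces_cons, faces_nil, sup_bot_eq,
          hdiff]
        constructor
        · intro h
          obtain ⟨b, hb, hrb⟩ := hcover (Set.Iio a) hne r h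
          exact Submodule.mem_iSup_of_mem b (Submodule.mem_iSup_of_mem hb hrb)
        · intro h
          have hle : (⨆ b, ⨆ (_ : b < a), N b) ≤ AddSubgroup.toIntSubmodule
              ((R (Subtype.val '' Set.Iio a : Set X)).addSubgroupOf (R V)) :=
            iSup_le fun b => iSup_le fun hb r hr =>
              R_mono (Set.image_mono (Set.Iic_subset_Iio.2 hb)) hr
          exact hle h
      · rintro _ ⟨r, rfl⟩
        exact diffOp_mem_R [(a : X)] (hj r)

theorem faceSum_eq_faces (Y : Set X) {n : ℕ} (x : Fin n → X) (hxY : ∀ l, x l ∉ Y) :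
    faceSum Y x = faces R (Set.range x ∪ Y) (List.ofFn x) := by
  have h : ∀ l, (Set.range x \ {x l}) ∪ Y = (Set.range x ∪ Y) \ {x l} := by
    intro l
    rw [Set.union_sdiff_distrib, Set.sdiff_singleton_eq_self (hxY l)]
  simp only [faceSum, faces, h]
  refine le_antisymm (iSup_le fun l => ?_) (iSup₂_le fun y hy => ?_)
  · exact le_iSup₂_of_le (x l) ((List.mem_ofFn' _ _).2 ⟨l, rfl⟩) le_rfl
  · obtain ⟨l, rfl⟩ := (List.mem_ofFn' _ _).1 hy
    exact le_iSup_of_le l le_rfl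

end FreeRing

theorem mainTheorem2 {X : Type*} :
    Module.Free ℤ (FreeRing.R (Set.univ : Set X)) ∧
    ∀ (Y : Set X) (n : ℕ) (x : Fin n → X), Function.Injective x → (∀ l, x l ∉ Y) →
      Module.Free ℤ
        (FreeRing.R (Set.range x ∪ Y) ⧸
          (FreeRing.faceSum Y x).addSubgroupOf (FreeRing.R (Set.range x ∪ Y))) := by
  refine ⟨FreeRing.free_R _, fun Y n x hx hxY => ?_⟩
  rw [FreeRing.faceSum_eq_faces Y x hxY]
  exact FreeRing.free_quotient_faces (List.nodup_ofFn.2 hx) _ (FreeRing.free_R _)
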